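/- Let $(X,d)$ be a complete separable metric space and let $\mu,\nu$ be Borel probability measures on $X$. For $A\subset X$ and $\varepsilon>0$ let $U_\varepsilon(A)=\{x\in X : d(x,a)<\varepsilon \text{ for some } a\in A\}$, and let $$d_P(\mu,\nu)=\inf\{\varepsilon>0 : \mu(U_\varepsilon(A))\ge \nu(A)-\varepsilon \text{ for every Borel set } A\subset X\}$$ be the Prohorov distance. Let $\Pi(\mu,\nu)$ be the set of Borel probability measures on $X\times X$ whose first and second marginals are $\mu$ and $\nu$. For a nonempty set $S\subset X\times X$ put $\operatorname{dis}_\Delta S=\sup\{d(x,y) : (x,y)\in S\}\in[0,\infty]$, and put $\operatorname{dis}_\Delta\emptyset=0$. Then $$d_P(\mu,\nu)=\min_{\pi,\,S}\ \max\{\operatorname{dis}_\Delta S,\ 1-\pi(S)\},$$ where $\pi$ runs over $\Pi(\mu,\nu)$ and $S$ runs over all closed subsets of $X\times X$. In particular the minimum is attained: there are $\pi\in\Pi(\mu,\nu)$ and a closed set $S\subset X\times X$ with $d_P(\mu,\nu)=\max\{\operatorname{dis}_\Delta S,1-\pi(S)\}$. -/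

import Mathlib

open MeasureTheory
open scoped ENNReal

/-- The Prohorov distance `inf {ε > 0 | μ (U_ε A) ≥ ν A - ε for every Borel set A}`, where
`U_ε A` is the open `ε`-neighbourhood of `A` (empty if `A` is empty). -/
noncomputable def prohorovDist {X : Type*} [MetricSpace X] [MeasurableSpace X]
    (μ ν : Measure X) : ℝ :=
  sInf {ε : ℝ | 0 < ε ∧
    ∀ A : Set X, MeasurableSet A → ν.real A - ε ≤ μ.real (Metric.thickening ε A)}

/-- `π` is a transport plan (coupling) between `μ` and `ν`: a probability measure on the product
whose first and second marginals are `μ` and `ν`. -/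
structure IsTransportPlan {X Y : Type*} [MeasurableSpace X] [MeasurableSpace Y]
    (μ : Measure X) (ν : Measure Y) (π : Measure (X × Y)) : Prop where
  isProbabilityMeasure : IsProbabilityMeasure π
  map_fst : π.map Prod.fst = μ
  map_snd : π.map Prod.snd = ν

/-- `disDelta S = sup {d(x, y) | (x, y) ∈ S}` as an extended nonnegative number; it is `0` for
the empty set and `∞` if the distances are unbounded on `S`. -/
noncomputable def disDelta {X : Type*} [MetricSpace X] (S : Set (X × X)) : ℝ≥0∞ :=
  ⨆ p ∈ S, edist p.1 p.2

/-- On probability measures `prohorovDist`, which is written with a one-sided condition, agrees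
with Mathlib's Lévy-Prokhorov distance. -/
theorem prohorovDist_eq_levyProkhorovDist {X : Type*} [MetricSpace X] [MeasurableSpace X]
    [BorelSpace X] (μ ν : Measure X) [IsProbabilityMeasure μ] [IsProbabilityMeasure ν] :
    prohorovDist μ ν = levyProkhorovDist μ ν := by
  apply le_antisymm
  · refine le_of_forall_gt_imp_ge_of_dense fun c hc => ?_
    have h0 : 0 ≤ levyProkhorovDist μ ν := ENNReal.toReal_nonneg
    have hc0 : 0 < c := h0.trans_lt hc
    have hlt : levyProkhorovEDist μ ν < ENNReal.ofReal c :=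
      (ENNReal.lt_ofReal_iff_toReal_lt (levyProkhorovEDist_ne_top μ ν)).2 hc
    refine csInf_le ⟨0, fun x hx => hx.1.le⟩ ⟨hc0, fun A hA => ?_⟩
    have h := right_measure_le_of_levyProkhorovEDist_lt hlt hA
    rw [ENNReal.toReal_ofReal hc0.le] at h
    have h2 := ENNReal.toReal_mono (by finiteness) h
    rw [ENNReal.toReal_add (by finiteness) (by finiteness), ENNReal.toReal_ofReal hc0.le] at h2
    simp only [Measure.real]
    linarith
  · refine le_csInf ⟨1, one_pos, fun A _ => ?_⟩ fun ε ⟨hε, h⟩ => ?_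
    · have h1 : ν.real A ≤ 1 := measureReal_le_one
      have h2 : 0 ≤ μ.real (Metric.thickening 1 A) := measureReal_nonneg
      linarith
    refine ENNReal.toReal_le_of_le_ofReal hε.le (sInf_le fun B hB => ?_)
    rw [ENNReal.toReal_ofReal hε.le]
    have key : ∀ s t : Set X, ∀ m n : Measure X, IsProbabilityMeasure m →
        IsProbabilityMeasure n → m.real s ≤ n.real t + ε → m s ≤ n t + ENNReal.ofReal ε := by
      intro s t m n _ _ hst
      rw [← ofReal_measureReal, ← ofReal_measureReal (μ := n),
        ← ENNReal.ofReal_add measureReal_nonneg hε.le]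
      exact ENNReal.ofReal_le_ofReal hst
    refine ⟨key _ _ _ _ inferInstance inferInstance ?_,
      key _ _ _ _ inferInstance inferInstance (by linarith [h B hB])⟩
    have hU : MeasurableSet (Metric.thickening ε B) := Metric.isOpen_thickening.measurableSet
    have h1 := h _ hU.compl
    have hsub : Metric.thickening ε (Metric.thickening ε B)ᶜ ⊆ Bᶜ := by
      intro x hx hxB
      obtain ⟨z, hz, hxz⟩ := Metric.mem_thickening_iff.1 hx
      exact hz (Metric.mem_thickening_iff.2 ⟨x, hxB, by rwa [dist_comm]⟩)
    have h2 : μ.real (Metric.thickening ε (Metric.thickening ε B)ᶜ) ≤ μ.real Bᶜ :=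
      measureReal_mono hsub
    rw [probReal_compl_eq_one_sub hB] at h2
    rw [probReal_compl_eq_one_sub hU] at h1
    linarith

/-! One inequality is direct: if `y ∈ A` and `(x, y) ∈ S`, then `x` is within `disDelta S` of `A`,
so `ν A ≤ μ (U_ε A) + 1 - π S` whenever `ε > disDelta S`.

The converse is Strassen's theorem. For empirical measures with `N` atoms each, the Prohorov
condition is Hall's condition with defect `⌊εN⌋`, so a permutation matches all but that many atoms
within `ε`. By the strong law, general measures are weak limits of empirical ones. Convergent
marginals are tight, hence so are the plans, and a subsequence converges to a plan `π` with `π {dist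
≤ c} ≥ 1 - c` for every `c > d_P`. The same `π` serves all `c`, so `c` may decrease to `d_P`, and
the closed set `{dist ≤ d_P}` attains the minimum. -/

open ProbabilityTheory Filter
open scoped Topology

/-! ### Matchings and empirical measures -/

/-- Defect version of **Hall's marriage theorem**. -/
theorem exists_perm_card_not_rel_le {ι : Type*} [Fintype ι] (r : ι → ι → Prop) (k : ℕ)
    (h : ∀ A : Set ι, A.ncard ≤ {b | ∃ a ∈ A, r a b}.ncard + k) :
    ∃ σ : Equiv.Perm ι, {a | ¬ r a (σ a)}.ncard ≤ k := by
  classical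
  -- Adding `k` dummy partners acceptable to everyone restores Hall's condition; only indices
  -- matched to a dummy can fail `r`.
  let r' : ι → ι ⊕ Fin k → Prop := fun a => Sum.elim (r a) fun _ => True
  obtain ⟨f, hf, hfr⟩ := (Fintype.all_card_le_filter_rel_iff_exists_injective r').1 fun A => by
    rcases A.eq_empty_or_nonempty with rfl | ⟨a, ha⟩
    · simp
    have h2 : (Finset.univ.filter fun b => ∃ a ∈ A, r' a b) =
        (Finset.univ.filter fun b => ∃ a ∈ A, r a b).disjSum Finset.univ := by
      ext (b | b)
      · simp [r']
      · simpa [r'] using ⟨a, ha⟩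
    rw [h2, Finset.card_disjSum, Finset.card_univ, Fintype.card_fin]
    have := h A
    rwa [Set.ncard_coe_finset, Set.ncard_eq_toFinset_card', Set.toFinset_ofPred] at this
  let s : Set ι := {a | (f a).isLeft}
  -- The value off `s` is irrelevant: `g` is injective on `s`, and only that part is extended to a
  -- permutation.
  let g : ι → ι := fun a => Sum.elim id (fun _ => a) (f a)
  have hg : ∀ a ∈ s, f a = Sum.inl (g a) := by
    intro a ha
    obtain ⟨b, hb⟩ := Sum.isLeft_iff.1 ha
    simp [g, hb]
  obtain ⟨e, he⟩ := Set.MapsTo.exists_equiv_extend_of_card_eq (t := Finset.univ) (by simp)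
    (s := s) (f := g) (fun _ _ => by simp)
    (fun a ha b hb hab => hf <| by rw [hg a ha, hg b hb, hab])
  refine ⟨e.trans (Equiv.subtypeUnivEquiv Finset.mem_univ), ?_⟩
  have hsub : {a | ¬ r a (e a)} ⊆ sᶜ := by
    intro a ha has
    have := hfr a
    rw [hg a has] at this
    exact ha (by rw [he a has]; exact this)
  refine (Set.ncard_le_ncard hsub).trans ?_
  have himg : f '' sᶜ ⊆ Set.range (Sum.inr : Fin k → ι ⊕ Fin k) := by
    rintro _ ⟨a, ha, rfl⟩
    obtain ⟨b, hb⟩ := Sum.isRight_iff.1 (Sum.not_isLeft.1 ha)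
    exact ⟨b, hb.symm⟩
  rw [← Set.ncard_image_of_injective _ hf]
  refine (Set.ncard_le_ncard himg).trans ?_
  rw [← Set.image_univ, Set.ncard_image_of_injective _ Sum.inr_injective, Set.ncard_univ,
    Nat.card_fin]

/-- The uniform distribution on the values of a function on a finite nonempty type. -/
noncomputable def empiricalMeasure {ι X : Type*} [Finite ι] [Nonempty ι] [MeasurableSpace X]
    (x : ι → X) : ProbabilityMeasure X :=
  letI : MeasurableSpace ι := ⊤
  ⟨(uniformOn (Set.univ : Set ι)).map x,
    Measure.isProbabilityMeasure_map Measurable.of_discrete.aemeasurable⟩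

section Empirical

variable {ι X Y : Type*} [Fintype ι] [Nonempty ι] [MeasurableSpace X] [MeasurableSpace Y]

theorem empiricalMeasure_apply (x : ι → X) {A : Set X} (hA : MeasurableSet A) :
    (empiricalMeasure x : Measure X) A = (x ⁻¹' A).ncard / Fintype.card ι := by
  let : MeasurableSpace ι := ⊤
  change (uniformOn (Set.univ : Set ι)).map x A = _
  rw [Measure.map_apply Measurable.of_discrete hA, uniformOn_univ,
    Measure.count_apply_finite _ (Set.toFinite _), Set.ncard_eq_toFinset_card]

theorem empiricalMeasure_real (x : ι → X) {A : Set X} (hA : MeasurableSet A) :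
    (empiricalMeasure x : Measure X).real A = (x ⁻¹' A).ncard / Fintype.card ι := by
  simp [Measure.real, empiricalMeasure_apply x hA]

theorem map_empiricalMeasure (x : ι → X) {f : X → Y} (hf : Measurable f) :
    (empiricalMeasure x : Measure X).map f = empiricalMeasure (f ∘ x) := by
  ext A hA
  rw [Measure.map_apply hf hA, empiricalMeasure_apply _ (hf hA), empiricalMeasure_apply _ hA]
  rfl

theorem empiricalMeasure_comp_equiv (x : ι → X) (σ : Equiv.Perm ι) :
    empiricalMeasure (x ∘ σ) = empiricalMeasure x := by
  refine Subtype.ext (Measure.ext fun A hA => ?_)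
  change (empiricalMeasure (x ∘ σ) : Measure X) A = (empiricalMeasure x : Measure X) A
  rw [empiricalMeasure_apply _ hA, empiricalMeasure_apply _ hA, Set.preimage_comp,
    ← σ.image_symm_eq_preimage, Set.ncard_image_of_injective _ σ.symm.injective]

end Empirical

/-- **Strassen's theorem** for empirical measures of equal size. -/
theorem exists_transportPlan_empiricalMeasure {ι X : Type*} [Fintype ι] [Nonempty ι]
    [MetricSpace X] [MeasurableSpace X] [BorelSpace X] [SecondCountableTopology X]
    (x y : ι → X) {ε : ℝ} (hε : 0 ≤ ε)
    (h : ∀ A : Set X, MeasurableSet A → (empiricalMeasure y : Measure X).real A - ε ≤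
      (empiricalMeasure x : Measure X).real (Metric.thickening ε A)) :
    ∃ π : ProbabilityMeasure (X × X),
      IsTransportPlan (empiricalMeasure x : Measure X) (empiricalMeasure y : Measure X)
        (π : Measure (X × X)) ∧
      1 - ε ≤ (π : Measure (X × X)).real {p | dist p.1 p.2 ≤ ε} := by
  have hN : (0 : ℝ) < Fintype.card ι := by exact_mod_cast Fintype.card_pos
  -- Hall's condition for a set `J` of `y`-indices is the Prohorov condition for `A = y '' J`,
  -- multiplied by `N`.
  obtain ⟨σ, hσ⟩ := exists_perm_card_not_rel_le (fun j i => dist (x i) (y j) < ε)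
    ⌊ε * Fintype.card ι⌋₊ fun J => by
      have h1 := h (y '' J) (Set.toFinite _).measurableSet
      rw [empiricalMeasure_real _ (Set.toFinite _).measurableSet,
        empiricalMeasure_real _ Metric.isOpen_thickening.measurableSet] at h1
      have h2 : x ⁻¹' Metric.thickening ε (y '' J) = {i | ∃ j ∈ J, dist (x i) (y j) < ε} := by
        ext i
        simp [Metric.mem_thickening_iff]
      have h3 : J.ncard ≤ (y ⁻¹' (y '' J)).ncard :=
        Set.ncard_le_ncard (Set.subset_preimage_image _ _)
      rw [h2, sub_le_iff_le_add, div_add' _ _ _ hN.ne', div_le_div_iff_of_pos_right hN] at h1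
      -- Since the counts are integers, `εN < ⌊εN⌋ + 1` lets the defect be rounded down.
      refine Nat.lt_add_one_iff.1 ?_
      have h4 := Nat.lt_floor_add_one (ε * Fintype.card ι)
      have h5 : (J.ncard : ℝ) ≤ (y ⁻¹' (y '' J)).ncard := by exact_mod_cast h3
      have h6 : (J.ncard : ℝ) < {i | ∃ j ∈ J, dist (x i) (y j) < ε}.ncard +
          ⌊ε * Fintype.card ι⌋₊ + 1 := by linarith
      exact_mod_cast h6
  refine ⟨empiricalMeasure fun j => (x (σ j), y j), ⟨inferInstance, ?_, ?_⟩, ?_⟩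
  · rw [map_empiricalMeasure _ measurable_fst, ← empiricalMeasure_comp_equiv x σ]
    rfl
  · rw [map_empiricalMeasure _ measurable_snd]
    rfl
  have hm : MeasurableSet {p : X × X | dist p.1 p.2 ≤ ε} :=
    measurableSet_le measurable_dist measurable_const
  rw [← compl_compl {p : X × X | dist p.1 p.2 ≤ ε}, probReal_compl_eq_one_sub hm.compl,
    empiricalMeasure_real _ hm.compl]
  have h1 : ((fun j => (x (σ j), y j)) ⁻¹' {p : X × X | dist p.1 p.2 ≤ ε}ᶜ).ncard ≤
      ⌊ε * Fintype.card ι⌋₊ := by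
    refine (Set.ncard_le_ncard fun j hj => ?_).trans hσ
    simp only [Set.mem_preimage, Set.mem_compl_iff, Set.mem_ofPred_eq, not_le, not_lt] at hj ⊢
    exact hj.le
  have h2 := (Nat.cast_le.2 h1).trans (Nat.floor_le (by positivity : 0 ≤ ε * Fintype.card ι))
  gcongr
  rwa [div_le_iff₀ hN]

/-! ### Approximation by empirical measures -/

/-- Countability allows almost sure convergence of frequencies on all these sets simultaneously, and
such a π-system determines weak convergence. -/
theorem exists_countable_piSystem_isOpen (X : Type*) [TopologicalSpace X]
    [SecondCountableTopology X] :
    ∃ S : Set (Set X), S.Countable ∧ IsPiSystem S ∧ (∀ s ∈ S, IsOpen s) ∧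
      ∀ u : Set X, IsOpen u → ∀ x ∈ u, ∃ s ∈ S, s ∈ 𝓝 x ∧ s ⊆ u := by
  obtain ⟨B, hBc, -, hB⟩ := TopologicalSpace.exists_countable_basis X
  refine ⟨Set.sInter '' {f | f.Finite ∧ f ⊆ B},
    (Set.countable_ofPred_finite_subset hBc).image _, ?_, ?_, ?_⟩
  · rintro _ ⟨f, ⟨hf, hfB⟩, rfl⟩ _ ⟨g, ⟨hg, hgB⟩, rfl⟩ -
    exact ⟨f ∪ g, ⟨hf.union hg, Set.union_subset hfB hgB⟩, Set.sInter_union f g⟩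
  · rintro _ ⟨f, ⟨hf, hfB⟩, rfl⟩
    exact hf.isOpen_sInter fun s hs => hB.isOpen (hfB hs)
  · intro u hu x hx
    obtain ⟨s, hs, hxs, hsu⟩ := hB.exists_subset_of_mem_open hx hu
    exact ⟨s, ⟨{s}, ⟨Set.finite_singleton s, by simpa using hs⟩, Set.sInter_singleton s⟩,
      (hB.isOpen hs).mem_nhds hxs, hsu⟩

/-- Frequencies of an event in an i.i.d. sequence converge almost surely. -/
theorem ae_tendsto_ncard_div {X : Type*} [MeasurableSpace X] (μ : Measure X)
    [IsProbabilityMeasure μ] {A : Set X} (hA : MeasurableSet A) :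
    ∀ᵐ x ∂(Measure.infinitePi fun _ : ℕ => μ),
      Tendsto (fun n : ℕ => (((fun i : Fin (n + 1) => x i) ⁻¹' A).ncard : ℝ) / (n + 1 : ℕ))
        atTop (𝓝 (μ.real A)) := by
  have hm : Measurable (A.indicator fun _ => (1 : ℝ)) := measurable_const.indicator hA
  have hmap : ∀ i : ℕ, (Measure.infinitePi fun _ : ℕ => μ).map (fun x => x i) = μ :=
    fun i => Measure.infinitePi_map_eval _ i
  have hexp : ∫ x, A.indicator (fun _ => (1 : ℝ)) (x 0) ∂(Measure.infinitePi fun _ : ℕ => μ) =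
      μ.real A := by
    rw [← integral_map (φ := fun x : ℕ → X => x 0) (measurable_pi_apply 0).aemeasurable
      hm.aestronglyMeasurable, hmap 0]
    exact integral_indicator_one hA
  have key := strong_law_ae_real (μ := Measure.infinitePi fun _ : ℕ => μ)
    (fun i x => A.indicator (fun _ => (1 : ℝ)) (x i))
    (Integrable.of_bound (hm.comp (measurable_pi_apply 0)).aestronglyMeasurable 1
      (.of_forall fun x => (norm_indicator_le_norm_self _ _).trans (by simp)))
    (fun i j hij => (iIndepFun_infinitePi (P := fun _ : ℕ => μ)
      (X := fun _ => A.indicator fun _ => (1 : ℝ)) fun _ => hm).indepFun hij)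
    (fun i => ⟨(hm.comp (measurable_pi_apply i)).aemeasurable,
      (hm.comp (measurable_pi_apply 0)).aemeasurable, by
        have := fun i : ℕ => Measure.map_map (μ := Measure.infinitePi fun _ : ℕ => μ) hm
          (measurable_pi_apply i)
        simp only [hmap] at this
        exact (this i).symm.trans (this 0)⟩)
  rw [hexp] at key
  filter_upwards [key] with x hx
  refine (hx.comp (tendsto_add_atTop_nat 1)).congr fun n => ?_
  classical
  simp only [Function.comp_apply]
  congr 1
  rw [Finset.sum_range, Set.ncard_eq_toFinset_card']
  simp [Set.indicator_apply, Set.preimage]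

/-- Every Borel probability measure on a second countable metrizable space is a weak limit of
empirical measures. -/
theorem exists_tendsto_empiricalMeasure {X : Type*} [MetricSpace X] [SecondCountableTopology X]
    [MeasurableSpace X] [BorelSpace X] (μ : ProbabilityMeasure X) :
    ∃ x : ℕ → X,
      Tendsto (fun n : ℕ => empiricalMeasure fun i : Fin (n + 1) => x i) atTop (𝓝 μ) := by
  obtain ⟨S, hSc, hSpi, hSo, hS⟩ := exists_countable_piSystem_isOpen X
  have h := (ae_ball_iff hSc).2 fun s hs =>
    ae_tendsto_ncard_div (μ : Measure X) (hSo s hs).measurableSet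
  obtain ⟨x, hx⟩ := h.exists
  refine ⟨x, hSpi.tendsto_probabilityMeasure_of_tendsto_of_mem
    (fun s hs => (hSo s hs).measurableSet) hS fun s hs => ?_⟩
  rw [← NNReal.tendsto_coe]
  refine (hx s hs).congr fun n => ?_
  have := empiricalMeasure_real (fun i : Fin (n + 1) => x i) (hSo s hs).measurableSet
  rw [Fintype.card_fin] at this
  exact this.symm

/-! ### The lower bound and properties of the Prohorov distance -/

theorem prohorovDist_le_of_transportPlan {X : Type*} [MetricSpace X] [MeasurableSpace X]
    [BorelSpace X] {μ ν : Measure X} [IsProbabilityMeasure μ] [IsProbabilityMeasure ν]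
    {π : Measure (X × X)} (hπ : IsTransportPlan μ ν π) (S : Set (X × X))
    (hS : MeasurableSet S) :
    ENNReal.ofReal (prohorovDist μ ν) ≤ max (disDelta S) (1 - π S) := by
  have := hπ.isProbabilityMeasure
  set v := max (disDelta S) (1 - π S) with hv
  -- The slack `r` is needed because thickenings are open, while distances on `S` may equal `v`.
  refine ENNReal.le_of_forall_pos_le_add fun r hr hvt => ?_
  have hr' : (0 : ℝ) < r := hr
  have hc0 : 0 < v.toReal + r := add_pos_of_nonneg_of_pos ENNReal.toReal_nonneg hr'
  have hc : v + r = ENNReal.ofReal (v.toReal + r) := by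
    rw [ENNReal.ofReal_add ENNReal.toReal_nonneg hr'.le, ENNReal.ofReal_toReal hvt.ne,
      ENNReal.ofReal_coe_nnreal]
  rw [hc]
  refine ENNReal.ofReal_le_ofReal (csInf_le ⟨0, fun x hx => hx.1.le⟩ ⟨hc0, fun A hA => ?_⟩)
  have hlt : v < ENNReal.ofReal (v.toReal + r) := by
    rw [← hc]
    exact ENNReal.lt_add_right hvt.ne (by simpa using hr.ne')
  have hsub : Prod.snd ⁻¹' A ⊆ Prod.fst ⁻¹' Metric.thickening (v.toReal + r) A ∪ Sᶜ := by
    intro p hp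
    refine or_iff_not_imp_right.2 fun hpS => ?_
    refine Metric.mem_thickening_iff_exists_edist_lt .. |>.2 ⟨p.2, hp, lt_of_le_of_lt ?_ hlt⟩
    exact (le_iSup₂ (f := fun (p : X × X) (_ : p ∈ S) => edist p.1 p.2) p (not_not.1 hpS)).trans
      (le_max_left _ _)
  have hU : MeasurableSet (Metric.thickening (v.toReal + r) A) :=
    Metric.isOpen_thickening.measurableSet
  have h1 : ν A ≤ μ (Metric.thickening (v.toReal + r) A) + ENNReal.ofReal (v.toReal + r) := by
    calc ν A = π (Prod.snd ⁻¹' A) := by rw [← hπ.map_snd, Measure.map_apply measurable_snd hA]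
      _ ≤ π (Prod.fst ⁻¹' Metric.thickening (v.toReal + r) A) + π Sᶜ :=
        (measure_mono hsub).trans (measure_union_le _ _)
      _ ≤ _ := by
        rw [← hπ.map_fst, Measure.map_apply measurable_fst hU, prob_compl_eq_one_sub hS]
        gcongr
        exact (le_max_right _ _).trans hlt.le
  have h2 := ENNReal.toReal_mono (by finiteness) h1
  rw [ENNReal.toReal_add (by finiteness) (by finiteness), ENNReal.toReal_ofReal hc0.le] at h2
  simp only [Measure.real]
  linarith

/-- The admissible `ε` form an up-set, since thickenings grow with `ε`. -/
theorem sub_le_measureReal_thickening_of_prohorovDist_lt {X : Type*} [MetricSpace X]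
    [MeasurableSpace X] {μ ν : Measure X} [IsProbabilityMeasure μ]
    [IsProbabilityMeasure ν] {ε : ℝ} (h : prohorovDist μ ν < ε) {A : Set X}
    (hA : MeasurableSet A) : ν.real A - ε ≤ μ.real (Metric.thickening ε A) := by
  have hne : {ε : ℝ | 0 < ε ∧ ∀ A : Set X, MeasurableSet A →
      ν.real A - ε ≤ μ.real (Metric.thickening ε A)}.Nonempty := by
    refine ⟨1, one_pos, fun A _ => ?_⟩
    have h1 : ν.real A ≤ 1 := measureReal_le_one
    have h2 : 0 ≤ μ.real (Metric.thickening 1 A) := measureReal_nonneg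
    linarith
  obtain ⟨δ, ⟨-, hδ⟩, hlt⟩ := exists_lt_of_csInf_lt hne h
  have h3 : μ.real (Metric.thickening δ A) ≤ μ.real (Metric.thickening ε A) :=
    measureReal_mono (Metric.thickening_mono hlt.le A)
  linarith [hδ A hA]

theorem prohorovDist_nonneg {X : Type*} [MetricSpace X] [MeasurableSpace X] (μ ν : Measure X) :
    0 ≤ prohorovDist μ ν :=
  Real.sInf_nonneg fun _ hx => hx.1.le

/-- Weak convergence implies Lévy-Prokhorov convergence, and a metric is jointly continuous. -/
theorem tendsto_prohorovDist {X ι : Type*} [MetricSpace X] [MeasurableSpace X] [BorelSpace X]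
    [SecondCountableTopology X] {l : Filter ι} {μs νs : ι → ProbabilityMeasure X}
    {μ ν : ProbabilityMeasure X} (hμ : Tendsto μs l (𝓝 μ)) (hν : Tendsto νs l (𝓝 ν)) :
    Tendsto (fun i => prohorovDist (μs i : Measure X) (νs i : Measure X)) l
      (𝓝 (prohorovDist (μ : Measure X) (ν : Measure X))) := by
  simp only [prohorovDist_eq_levyProkhorovDist]
  have hc := LevyProkhorov.continuous_ofMeasure_probabilityMeasure (Ω := X)
  exact ((hc.tendsto μ).comp hμ).dist ((hc.tendsto ν).comp hν)

/-! ### Compactness of plans and attainment -/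

/-- Transport plans between the terms of two weakly convergent sequences subconverge to a
transport plan between the limits. -/
theorem exists_subseq_tendsto_transportPlan {X : Type*} [MetricSpace X] [CompleteSpace X]
    [SecondCountableTopology X] [MeasurableSpace X] [BorelSpace X]
    {μs νs : ℕ → ProbabilityMeasure X} {μ ν : ProbabilityMeasure X}
    (hμ : Tendsto μs atTop (𝓝 μ)) (hν : Tendsto νs atTop (𝓝 ν))
    {πs : ℕ → ProbabilityMeasure (X × X)}
    (hπs : ∀ n, IsTransportPlan (μs n : Measure X) (νs n : Measure X) (πs n : Measure (X × X))) :
    ∃ (π : ProbabilityMeasure (X × X)) (φ : ℕ → ℕ), StrictMono φ ∧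
      IsTransportPlan (μ : Measure X) (ν : Measure X) (π : Measure (X × X)) ∧
      Tendsto (πs ∘ φ) atTop (𝓝 π) := by
  -- A convergent sequence with its limit is compact, so Prohorov's theorem on the complete
  -- separable space gives tightness.
  have htight : ∀ {ρs : ℕ → ProbabilityMeasure X} {ρ : ProbabilityMeasure X},
      Tendsto ρs atTop (𝓝 ρ) →
      IsTightMeasureSet {((m : ProbabilityMeasure X) : Measure X) | m ∈ Set.range ρs} :=
    fun h => isTightMeasureSet_of_isCompact_closure
      (h.isCompact_insert_range.closure_of_subset (Set.subset_insert _ _))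
  have hπt : IsTightMeasureSet
      {((m : ProbabilityMeasure (X × X)) : Measure (X × X)) | m ∈ Set.range πs} := by
    refine IsTightMeasureSet.prodMk ((htight hμ).subset ?_) ((htight hν).subset ?_)
    · rintro _ ⟨_, ⟨_, ⟨n, rfl⟩, rfl⟩, rfl⟩
      exact ⟨μs n, ⟨n, rfl⟩, (hπs n).map_fst.symm⟩
    · rintro _ ⟨_, ⟨_, ⟨n, rfl⟩, rfl⟩, rfl⟩
      exact ⟨νs n, ⟨n, rfl⟩, (hπs n).map_snd.symm⟩
  obtain ⟨π, -, φ, hφ, hlim⟩ := (isCompact_closure_of_isTightMeasureSet hπt).isSeqCompact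
    (x := πs) fun n => subset_closure ⟨n, rfl⟩
  have hmarg : ∀ {f : X × X → X} (hf : Continuous f) {ρs : ℕ → ProbabilityMeasure X}
      {ρ : ProbabilityMeasure X}, Tendsto ρs atTop (𝓝 ρ) →
      (∀ n, (πs n : Measure (X × X)).map f = ρs n) → (π : Measure (X × X)).map f = ρ := by
    intro f hf ρs ρ hρ h
    have h1 := ProbabilityMeasure.tendsto_map_of_tendsto_of_continuous _ _ hlim hf
    have h2 : (fun i => ((πs ∘ φ) i).map hf.measurable.aemeasurable) = ρs ∘ φ :=
      funext fun i => Subtype.ext (h (φ i))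
    rw [h2] at h1
    exact congrArg ProbabilityMeasure.toMeasure (tendsto_nhds_unique h1 (hρ.comp hφ.tendsto_atTop))
  exact ⟨π, φ, hφ, ⟨inferInstance, hmarg continuous_fst hμ fun n => (hπs n).map_fst,
    hmarg continuous_snd hν fun n => (hπs n).map_snd⟩, hlim⟩

/-- **Strassen's theorem**, in the limiting form. -/
theorem exists_transportPlan_forall_prohorovDist_lt {X : Type*} [MetricSpace X] [CompleteSpace X]
    [SecondCountableTopology X] [MeasurableSpace X] [BorelSpace X]
    (μ ν : ProbabilityMeasure X) :
    ∃ π : ProbabilityMeasure (X × X),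
      IsTransportPlan (μ : Measure X) (ν : Measure X) (π : Measure (X × X)) ∧
      ∀ c, prohorovDist (μ : Measure X) (ν : Measure X) < c →
        1 - ENNReal.ofReal c ≤ (π : Measure (X × X)) {p | dist p.1 p.2 ≤ c} := by
  obtain ⟨x, hx⟩ := exists_tendsto_empiricalMeasure μ
  obtain ⟨y, hy⟩ := exists_tendsto_empiricalMeasure ν
  set μs : ℕ → ProbabilityMeasure X := fun n => empiricalMeasure fun i : Fin (n + 1) => x i
  set νs : ℕ → ProbabilityMeasure X := fun n => empiricalMeasure fun i : Fin (n + 1) => y i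
  -- The vanishing excess makes `ε n` admissible even if the infimum is not.
  set ε : ℕ → ℝ := fun n =>
    prohorovDist (μs n : Measure X) (νs n : Measure X) + 1 / ((n : ℝ) + 1)
  have hlt : ∀ n, prohorovDist (μs n : Measure X) (νs n : Measure X) < ε n := fun n =>
    lt_add_of_pos_right _ Nat.one_div_pos_of_nat
  have hε : Tendsto ε atTop (𝓝 (prohorovDist (μ : Measure X) (ν : Measure X))) := by
    have := (tendsto_prohorovDist hx hy).add (tendsto_one_div_add_atTop_nhds_zero_nat (𝕜 := ℝ))
    rwa [add_zero] at this
  choose πs hπs hπε using fun n => exists_transportPlan_empiricalMeasure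
    (fun i : Fin (n + 1) => x i) (fun i : Fin (n + 1) => y i)
    ((prohorovDist_nonneg _ _).trans (hlt n).le)
    fun A hA => sub_le_measureReal_thickening_of_prohorovDist_lt (hlt n) hA
  obtain ⟨π, φ, hφ, hπ, hlim⟩ := exists_subseq_tendsto_transportPlan hx hy hπs
  refine ⟨π, hπ, fun c hc => ?_⟩
  have hF : IsClosed {p : X × X | dist p.1 p.2 ≤ c} :=
    isClosed_le continuous_dist continuous_const
  refine le_trans ?_ (ProbabilityMeasure.limsup_measure_closed_le_of_tendsto hlim hF)
  refine le_limsup_of_frequently_le (Eventually.frequently ?_)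
  filter_upwards [(hε.comp hφ.tendsto_atTop).eventually_lt_const hc] with n hn
  have h1 : 1 - ε (φ n) ≤ (πs (φ n) : Measure (X × X)).real {p | dist p.1 p.2 ≤ c} :=
    (hπε (φ n)).trans (measureReal_mono fun p hp => le_trans hp hn.le)
  have hn' : ε (φ n) ≤ c := hn.le
  rw [← ENNReal.ofReal_one, ← ENNReal.ofReal_sub _
    ((prohorovDist_nonneg (μ : Measure X) (ν : Measure X)).trans hc.le)]
  refine (ENNReal.ofReal_le_ofReal ((sub_le_sub_left hn' 1).trans h1)).trans_eq ?_
  exact ofReal_measureReal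

/-- Continuity from above along the sets `{dist ≤ d + 1/(n+1)}`, which decrease to `{dist ≤ d}`;
this turns an infimum into a minimum. -/
theorem one_sub_le_measure_dist_le {X : Type*} [MetricSpace X] [MeasurableSpace X]
    [BorelSpace X] [SecondCountableTopology X] {π : Measure (X × X)} [IsFiniteMeasure π] {d : ℝ}
    (h : ∀ c, d < c → 1 - ENNReal.ofReal c ≤ π {p | dist p.1 p.2 ≤ c}) :
    1 - ENNReal.ofReal d ≤ π {p | dist p.1 p.2 ≤ d} := by
  have hc : Tendsto (fun n : ℕ => d + 1 / ((n : ℝ) + 1)) atTop (𝓝 d) := by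
    simpa using tendsto_const_nhds.add (tendsto_one_div_add_atTop_nhds_zero_nat (𝕜 := ℝ))
  have hInter : {p : X × X | dist p.1 p.2 ≤ d} =
      ⋂ n : ℕ, {p | dist p.1 p.2 ≤ d + 1 / ((n : ℝ) + 1)} := by
    ext p
    simp only [Set.mem_iInter, Set.mem_ofPred_eq]
    exact ⟨fun hp n => hp.trans (le_add_of_nonneg_right Nat.one_div_pos_of_nat.le),
      fun hp => ge_of_tendsto' hc hp⟩
  have hanti : Antitone fun n : ℕ => {p : X × X | dist p.1 p.2 ≤ d + 1 / ((n : ℝ) + 1)} :=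
    fun m n hmn p hp => le_trans hp (add_le_add_right (Nat.one_div_le_one_div hmn) d)
  rw [hInter]
  refine le_of_tendsto_of_tendsto'
    (f := fun n : ℕ => 1 - ENNReal.ofReal (d + 1 / ((n : ℝ) + 1)))
    (ENNReal.Tendsto.sub tendsto_const_nhds (ENNReal.tendsto_ofReal hc) (.inl ENNReal.one_ne_top))
    (tendsto_measure_iInter_atTop
      (fun n => (measurableSet_le measurable_dist measurable_const).nullMeasurableSet) hanti
      ⟨0, measure_ne_top _ _⟩)
    fun n => h _ (lt_add_of_pos_right _ Nat.one_div_pos_of_nat)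

theorem mainTheorem8 {X : Type*} [MetricSpace X] [CompleteSpace X]
    [TopologicalSpace.SeparableSpace X] [MeasurableSpace X] [BorelSpace X]
    (μ ν : Measure X) [IsProbabilityMeasure μ] [IsProbabilityMeasure ν] :
    IsLeast
      {v : ℝ≥0∞ | ∃ (π : Measure (X × X)) (S : Set (X × X)),
        IsTransportPlan μ ν π ∧ IsClosed S ∧ v = max (disDelta S) (1 - π S)}
      (ENNReal.ofReal (prohorovDist μ ν)) := by
  have : SecondCountableTopology X := UniformSpace.secondCountable_of_separable X
  have hlower : ∀ (π : Measure (X × X)) (S : Set (X × X)), IsTransportPlan μ ν π → IsClosed S →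
      ENNReal.ofReal (prohorovDist μ ν) ≤ max (disDelta S) (1 - π S) :=
    fun π S hπ hS => prohorovDist_le_of_transportPlan hπ S hS.measurableSet
  refine ⟨?_, ?_⟩
  · obtain ⟨π, hπ, h⟩ := exists_transportPlan_forall_prohorovDist_lt
      (⟨μ, inferInstance⟩ : ProbabilityMeasure X) ⟨ν, inferInstance⟩
    have hS : IsClosed {p : X × X | dist p.1 p.2 ≤ prohorovDist μ ν} :=
      isClosed_le continuous_dist continuous_const
    refine ⟨π, _, hπ, hS, le_antisymm (hlower π _ hπ hS) (max_le ?_ ?_)⟩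
    · refine iSup₂_le fun p hp => ?_
      rw [edist_dist]
      exact ENNReal.ofReal_le_ofReal hp
    · exact tsub_le_iff_tsub_le.1 (one_sub_le_measure_dist_le h)
  · rintro _ ⟨π, S, hπ, hS, rfl⟩
    exact hlower π S hπ hS
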